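/- A $3$-graph $G$ on $[n]=\{1,\dots,n\}$ is given by a set $E(G)$ of $3$-element subsets of $[n]$; its Lagrangian is $$\lambda(G)=\max\Big\{\sum_{ijk\in E(G)}x_ix_jx_k : x_1,\dots,x_n\ge 0,\ \sum_{i=1}^n x_i=1\Big\}.$$ Write $[t]^{(3)}$ for the complete $3$-graph on $[t]$. A clique of order $t$ in $G$ is a set of $t$ vertices all of whose $3$-element subsets are edges of $G$. $G$ is left-compressed if, whenever $j_1<j_2<j_3$ form an edge and $i_1<i_2<i_3$ satisfy $i_p\le j_p$ for $p=1,2,3$, then $i_1,i_2,i_3$ form an edge. **Lemma 3.1.** Let $m$ and $l$ be positive integers with $$\binom{l-1}{3}\le m\le\binom{l-1}{3}+\binom{l-2}{2},$$ where $\binom{a}{b}=0$ for $a<b$. Then at least one of the following holds. 1. There is a left-compressed $3$-graph $G$ on the vertex set $[l]$ with $m$ edges and without a clique of order $l-1$ such that $\lambda(G)=\lambda^-_{(m,l-1)}$, where $$\lambda^-_{(m,l-1)}=\max\{\lambda(G') : G' \text{ is a } 3\text{-graph on } [n] \text{ for some } n,\text{ with } m \text{ edges and without a clique of order } l-1\}$$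 (in particular, this maximum exists). 2. The Peng–Zhao conjecture holds for $r=3$ and these $m$ and $l$: every $3$-graph $G'$ with $m$ edges and without a clique of order $l-1$ (on $[n]$, for any $n$) satisfies $\lambda(G')<\lambda([l-1]^{(3)})$. -/

import Mathlib

/-- An `r`-uniform graph whose vertex set is the `n`-element ordered set `Fin n`
(standing for `[n] = {1, …, n}`, with `i : Fin n` in the role of `i + 1`). -/
@[ext]
structure RGraph (r n : ℕ) where
  /-- the edge set -/
  edges : Finset (Finset (Fin n))
  /-- every edge has exactly `r` vertices -/
  card_of_mem : ∀ e ∈ edges, e.card = r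

namespace RGraph

/-- The complete `r`-graph `[n]^{(r)}`. -/
def complete (r n : ℕ) : RGraph r n where
  edges := Finset.powersetCard r Finset.univ
  card_of_mem _ he := (Finset.mem_powersetCard.mp he).2

variable {r n : ℕ}

/-- `G` contains a clique of order `t`: some `t` vertices span all their `r`-subsets. -/
def HasClique (G : RGraph r n) (t : ℕ) : Prop :=
  ∃ S : Finset (Fin n), S.card = t ∧ Finset.powersetCard r S ⊆ G.edges

/-- `λ(G, x)`, the sum over the edges of the products of the weights of their vertices. -/
def weight (G : RGraph r n) (x : Fin n → ℝ) : ℝ :=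
  ∑ e ∈ G.edges, ∏ i ∈ e, x i

/-- The Lagrangian `λ(G)`: the maximum of `λ(G, x)` over the standard simplex.
For `n ≥ 1` the supremum is attained, see `isGreatest_lagrangian`. -/
noncomputable def lagrangian (G : RGraph r n) : ℝ :=
  sSup (G.weight '' stdSimplex ℝ (Fin n))

theorem isGreatest_lagrangian (G : RGraph r n) (hn : 0 < n) :
    IsGreatest (G.weight '' stdSimplex ℝ (Fin n)) G.lagrangian := by
  have hc : IsCompact (G.weight '' stdSimplex ℝ (Fin n)) := by
    refine (isCompact_stdSimplex ℝ (Fin n)).image ?_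
    unfold weight
    fun_prop
  have hne : (G.weight '' stdSimplex ℝ (Fin n)).Nonempty :=
    ⟨_, _, single_mem_stdSimplex ℝ (⟨0, hn⟩ : Fin n), rfl⟩
  exact hc.isGreatest_sSup hne

/-- `G` is left-compressed: if `j₁ < ⋯ < j_r` form an edge and `i₁ < ⋯ < i_r` satisfy
`i_p ≤ j_p` for every `p`, then `i₁, …, i_r` form an edge. -/
def LeftCompressed (G : RGraph r n) : Prop :=
  ∀ i j : Fin r → Fin n, StrictMono i → StrictMono j → (∀ p, i p ≤ j p) →
    Finset.univ.image j ∈ G.edges → Finset.univ.image i ∈ G.edges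

/-- The set of all values `λ(G)`, where `G` is an `r`-graph (on any number of vertices) with
`m` edges and without a clique of order `t`. -/
def lagrangiansWithoutClique (r m t : ℕ) : Set ℝ :=
  {c | ∃ (n : ℕ) (G : RGraph r n), G.edges.card = m ∧ ¬ G.HasClique t ∧ G.lagrangian = c}

/-- The assertion of the Peng-Zhao conjecture for given `r`, `m` and `l`: every `r`-graph with
`m` edges and without a clique of order `l - 1` has Lagrangian smaller than that of
`[l-1]^{(r)}`. -/
def PengZhaoConjecture (r m l : ℕ) : Prop :=
  ∀ (n : ℕ) (G : RGraph r n), G.edges.card = m → ¬ G.HasClique (l - 1) →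
    G.lagrangian < (complete r (l - 1)).lagrangian

end RGraph

/-! Suppose the Peng–Zhao inequality fails for some `G`, and put `q = l - 1`. An optimal weighting
of `G` then has at most `q + 1 = l` positive weights (`card_support_le`). At each positive weight
the partial derivative is at least three times the Lagrangian. Cauchy–Schwarz at the heaviest
vertex, and a weighted sum of the derivatives over the support, give two inequalities that conflict
when the support has `q + 2` or more vertices.

So `G` can be moved to `[l]` with decreasing weights and described by its non-edges
(`exists_nonedges`). No vertex lies in all non-edges, since the other `l - 1` vertices would form a
clique. If at least four non-edges are needed, they can be exchanged for equally many of no larger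
total weight that include all four triples of the last four vertices (`exists_superset_lastFour`).
Any `l - 1` vertices contain three of the last four, so these four non-edges alone exclude the
clique. Moving non-edges to the right keeps this block, does not raise the lost weight, and ends in
an up-closed family (`exists_upper_family`). Its complement is left-compressed with `m` edges and
Lagrangian at least that of `G`. There are finitely many 3-graphs on `[l]`, so a best one exists.

The upper bound on `m` leaves at least `l - 2` non-edges. For `l ≥ 5` fewer than four remain only
when `l = 5`, `m = 7`, where the Peng–Zhao inequality is proved directly. -/

namespace RGraph

/-! ### First-order conditions for an optimal weighting -/

variable {r n : ℕ}

/-- The partial derivative of the weight polynomial at `x` in the direction of `v`. -/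
def linkWeight (G : RGraph r n) (x : Fin n → ℝ) (v : Fin n) : ℝ :=
  ∑ e ∈ G.edges with v ∈ e, ∏ i ∈ e.erase v, x i

theorem weight_update_sub (G : RGraph r n) (x : Fin n → ℝ) (v : Fin n) (t : ℝ) :
    G.weight (Function.update x v (x v - t)) = G.weight x - t * G.linkWeight x v := by
  unfold weight linkWeight
  rw [Finset.mul_sum, Finset.sum_filter, ← Finset.sum_sub_distrib]
  refine Finset.sum_congr rfl fun e _ => ?_
  split_ifs with hv
  · rw [← Finset.mul_prod_erase e _ hv, ← Finset.mul_prod_erase e x hv]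
    have : ∏ i ∈ e.erase v, Function.update x v (x v - t) i = ∏ i ∈ e.erase v, x i :=
      Finset.prod_congr rfl fun i hi => Function.update_of_ne (Finset.ne_of_mem_erase hi) _ _
    rw [this, Function.update_self]
    ring
  · rw [sub_zero]
    refine Finset.prod_congr rfl fun i hi => Function.update_of_ne ?_ _ _
    rintro rfl
    exact hv hi

theorem weight_smul (G : RGraph r n) (c : ℝ) (x : Fin n → ℝ) :
    G.weight (c • x) = c ^ r * G.weight x := by
  unfold weight
  rw [Finset.mul_sum]
  refine Finset.sum_congr rfl fun e he => ?_
  simp [Finset.prod_mul_distrib, G.card_of_mem e he]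

theorem weight_le_lagrangian (G : RGraph r n) {x : Fin n → ℝ} (hx : x ∈ stdSimplex ℝ (Fin n)) :
    G.weight x ≤ G.lagrangian := by
  have hn : 0 < n := by
    rcases Nat.eq_zero_or_pos n with rfl | h
    · have := hx.2
      simp at this
    · exact h
  exact (G.isGreatest_lagrangian hn).2 ⟨x, hx, rfl⟩

theorem lagrangian_nonneg (G : RGraph r n) : 0 ≤ G.lagrangian := by
  refine Real.sSup_nonneg ?_
  rintro _ ⟨x, hx, rfl⟩
  exact Finset.sum_nonneg fun e _ => Finset.prod_nonneg fun i _ => hx.1 i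

/-- Lower `x v` by `t` and rescale by `1 / (1 - t)`. Optimality gives `λ (1 - (1 - t)^3) ≤ t *
linkWeight`; divide by `t` and let `t` tend to 0. -/
theorem three_mul_lagrangian_le_linkWeight (G : RGraph 3 n) {x : Fin n → ℝ}
    (hx : x ∈ stdSimplex ℝ (Fin n)) (hopt : G.weight x = G.lagrangian) {v : Fin n}
    (hv : 0 < x v) : 3 * G.lagrangian ≤ G.linkWeight x v := by
  have hL := G.lagrangian_nonneg
  have key : ∀ t, 0 < t → t ≤ x v → t < 1 →
      G.lagrangian * (3 - 3 * t + t ^ 2) ≤ G.linkWeight x v := by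
    intro t ht0 htv ht1
    have h1 : 0 < 1 - t := by linarith
    have hy : (1 - t)⁻¹ • Function.update x v (x v - t) ∈ stdSimplex ℝ (Fin n) := by
      constructor
      · intro i
        refine mul_nonneg (inv_nonneg.2 h1.le) ?_
        by_cases hi : i = v
        · subst hi
          simpa using htv
        · simpa [hi] using hx.1 i
      · have h2 : ∑ i, Function.update x v (x v - t) i = 1 - t := by
          rw [Finset.sum_update_of_mem (Finset.mem_univ v), ← hx.2,
            ← Finset.add_sum_erase _ _ (Finset.mem_univ v), Finset.sdiff_singleton_eq_erase]
          ring
        simp only [Pi.smul_apply, smul_eq_mul, ← Finset.mul_sum, h2]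
        exact inv_mul_cancel₀ h1.ne'
    have h3 := G.weight_le_lagrangian hy
    rw [weight_smul, weight_update_sub, hopt, inv_pow, inv_mul_le_iff₀ (by positivity)] at h3
    have h4 : t * (G.lagrangian * (3 - 3 * t + t ^ 2)) ≤ t * G.linkWeight x v := by
      linear_combination h3
    exact le_of_mul_le_mul_left h4 ht0
  by_contra! hlt
  have hLpos : 0 < G.lagrangian := by
    have h0 : 0 ≤ G.linkWeight x v :=
      Finset.sum_nonneg fun e _ => Finset.prod_nonneg fun i _ => hx.1 i
    linarith
  set ε := 3 * G.lagrangian - G.linkWeight x v with hε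
  have hεpos : 0 < ε := by linarith
  obtain ⟨t, ht0, ht⟩ := exists_between
    (show 0 < min (min (x v) 1) (ε / (3 * G.lagrangian)) by positivity)
  have h1 : t < ε / (3 * G.lagrangian) := ht.trans_le (min_le_right _ _)
  have h2 : t < min (x v) 1 := ht.trans_le (min_le_left _ _)
  have h3 := key t ht0 (h2.trans_le (min_le_left _ _)).le (h2.trans_le (min_le_right _ _))
  rw [lt_div_iff₀ (by positivity)] at h1
  nlinarith [mul_nonneg hLpos.le (sq_nonneg t)]

theorem two_mul_sum_powersetCard_two {ι : Type*} [DecidableEq ι] (S : Finset ι) (x : ι → ℝ) :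
    2 * ∑ p ∈ S.powersetCard 2, ∏ i ∈ p, x i = (∑ i ∈ S, x i) ^ 2 - ∑ i ∈ S, x i ^ 2 := by
  induction S using Finset.induction_on with
  | empty => rw [Finset.powersetCard_eq_empty.2 (by simp)]; simp
  | insert a S ha ih =>
    rw [Finset.powersetCard_succ_insert ha, Finset.sum_union, mul_add, ih, Finset.sum_insert ha,
      Finset.sum_insert ha, Finset.sum_image]
    · have : ∑ p ∈ S.powersetCard 1, ∏ i ∈ insert a p, x i = x a * ∑ i ∈ S, x i := by
        rw [Finset.powersetCard_one, Finset.sum_map, Finset.mul_sum]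
        refine Finset.sum_congr rfl fun i hi => ?_
        have hne : a ≠ i := by
          rintro rfl
          exact ha hi
        simp [Finset.prod_pair hne]
      rw [this]
      ring
    · intro p hp p' hp' h
      have h1 : a ∉ p := fun h => ha ((Finset.mem_powersetCard.1 hp).1 h)
      have h2 : a ∉ p' := fun h => ha ((Finset.mem_powersetCard.1 hp').1 h)
      rw [← Finset.erase_insert h1, ← Finset.erase_insert h2]
      exact congrArg (fun s => Finset.erase s a) h
    · rw [Finset.disjoint_left]
      intro p hp hp'
      obtain ⟨p', _, rfl⟩ := Finset.mem_image.1 hp'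
      exact ha ((Finset.mem_powersetCard.1 hp).1 (Finset.mem_insert_self a p'))

/-- The vertices of positive weight. -/
noncomputable def support (x : Fin n → ℝ) : Finset (Fin n) := {i | 0 < x i}

theorem mem_support {x : Fin n → ℝ} {i : Fin n} : i ∈ support x ↔ 0 < x i := by
  simp [support]

theorem sum_support {x : Fin n → ℝ} (hx : x ∈ stdSimplex ℝ (Fin n)) :
    ∑ i ∈ support x, x i = 1 := by
  rw [← hx.2]
  refine Finset.sum_subset (Finset.subset_univ _) fun i _ hi => ?_
  rw [mem_support, not_lt] at hi
  exact le_antisymm hi (hx.1 i)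

/-- The link is at worst complete on the rest of the support, whose total weight is `1 - x v`;
Cauchy–Schwarz then bounds its sum over pairs. -/
theorem linkWeight_le (G : RGraph 3 n) {x : Fin n → ℝ} (hx : x ∈ stdSimplex ℝ (Fin n))
    {v : Fin n} (hv : 0 < x v) :
    2 * (((support x).card : ℝ) - 1) * G.linkWeight x v ≤
      (1 - x v) ^ 2 * (((support x).card : ℝ) - 2) := by
  classical
  set S := (support x).erase v with hS
  have hvS : v ∈ support x := mem_support.2 hv
  have hcard : (S.card : ℝ) = (support x).card - 1 := by
    rw [hS, Finset.card_erase_of_mem hvS, Nat.cast_sub (Finset.card_pos.2 ⟨v, hvS⟩)]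
    simp
  have hsum : ∑ i ∈ S, x i = 1 - x v := by
    rw [← sum_support hx, ← Finset.add_sum_erase _ _ hvS]
    ring
  have h1 : G.linkWeight x v ≤ ∑ p ∈ S.powersetCard 2, ∏ i ∈ p, x i := by
    unfold linkWeight
    have hinj : Set.InjOn (fun e : Finset (Fin n) => e.erase v)
        (G.edges.filter (v ∈ ·) : Finset (Finset (Fin n))) := by
      intro e he e' he' h
      rw [Finset.mem_coe, Finset.mem_filter] at he he'
      rw [← Finset.insert_erase he.2, ← Finset.insert_erase he'.2]
      exact congrArg (insert v) h
    rw [← Finset.sum_image (f := fun p => ∏ i ∈ p, x i) hinj]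
    have hnn : ∀ p : Finset (Fin n), 0 ≤ ∏ i ∈ p, x i := fun p =>
      Finset.prod_nonneg fun i _ => hx.1 i
    rw [← Finset.sum_filter_ne_zero]
    refine Finset.sum_le_sum_of_subset_of_nonneg (fun p hp => ?_) fun p _ _ => hnn p
    obtain ⟨hp, hp0⟩ := Finset.mem_filter.1 hp
    obtain ⟨e, he, rfl⟩ := Finset.mem_image.1 hp
    rw [Finset.mem_filter] at he
    rw [Finset.mem_powersetCard, Finset.card_erase_of_mem he.2, G.card_of_mem e he.1]
    refine ⟨fun i hi => ?_, rfl⟩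
    rw [hS, Finset.mem_erase, mem_support]
    refine ⟨Finset.ne_of_mem_erase hi, lt_of_le_of_ne (hx.1 i) fun h0 => hp0 ?_⟩
    exact Finset.prod_eq_zero hi h0.symm
  have h2 := two_mul_sum_powersetCard_two S x
  have h3 : (∑ i ∈ S, x i) ^ 2 ≤ S.card * ∑ i ∈ S, x i ^ 2 := sq_sum_le_card_mul_sum_sq
  rw [hsum] at h2 h3
  have h4 : (0 : ℝ) ≤ S.card := Nat.cast_nonneg _
  have h5 : ((support x).card : ℝ) - 2 = S.card - 1 := by rw [hcard]; ring
  rw [h5, ← hcard]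
  nlinarith [mul_le_mul_of_nonneg_left h1 h4]

theorem pair_sum_le_one {a b c : ℝ} (ha : 0 ≤ a) (hc : 0 ≤ c) (ha1 : a ≤ 1) (hb1 : b ≤ 1)
    (hc1 : c ≤ 1) : a * b + b * c + c * a - 2 * (a * b * c) ≤ 1 := by
  nlinarith [mul_nonneg (sub_nonneg.2 ha1) (sub_nonneg.2 hc1),
    mul_nonneg (mul_nonneg (sub_nonneg.2 ha1) (sub_nonneg.2 hb1)) hc,
    mul_nonneg (mul_nonneg ha (sub_nonneg.2 hb1)) (sub_nonneg.2 hc1)]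

theorem sum_weighted_links_le {x : Fin n → ℝ} (hx : ∀ i, 0 ≤ x i) {M : ℝ} (hM : 0 < M)
    (hxM : ∀ i, x i ≤ M) {e : Finset (Fin n)} (he : e.card = 3) :
    ∑ v ∈ e with 0 < x v, (3 * M - 2 * x v) * ∏ i ∈ e.erase v, x i ≤ 3 * M ^ 3 := by
  by_cases h : ∃ i ∈ e, x i = 0
  · obtain ⟨i, hi, hi0⟩ := h
    rw [Finset.sum_eq_zero]
    · positivity
    · intro v hv
      rw [Finset.mem_filter] at hv
      rw [Finset.prod_eq_zero (i := i) _ hi0, mul_zero]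
      refine Finset.mem_erase.2 ⟨?_, hi⟩
      rintro rfl
      exact hv.2.ne' hi0
  · push Not at h
    rw [Finset.filter_true_of_mem fun i hi => lt_of_le_of_ne (hx i) (h i hi).symm]
    obtain ⟨a, b, c, hab, hac, hbc, rfl⟩ := Finset.card_eq_three.1 he
    have h1 : ({a, b, c} : Finset (Fin n)).erase a = {b, c} := by ext; simp; grind
    have h2 : ({a, b, c} : Finset (Fin n)).erase b = {a, c} := by ext; simp; grind
    have h3 : ({a, b, c} : Finset (Fin n)).erase c = {a, b} := by ext; simp; grind
    rw [Finset.sum_insert (by simp [hab, hac]), Finset.sum_pair hbc, h1, h2, h3,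
      Finset.prod_pair hbc, Finset.prod_pair hac, Finset.prod_pair hab]
    have hd : ∀ i, 0 ≤ x i / M ∧ x i / M ≤ 1 := fun i =>
      ⟨div_nonneg (hx i) hM.le, (div_le_one hM).2 (hxM i)⟩
    have h4 := pair_sum_le_one (hd a).1 (hd c).1 (hd a).2 (hd b).2 (hd c).2
    have h5 := mul_le_mul_of_nonneg_left h4 (show 0 ≤ 3 * M ^ 3 by positivity)
    have h6 : 3 * M ^ 3 * (x a / M * (x b / M) + x b / M * (x c / M) + x c / M * (x a / M) -
        2 * (x a / M * (x b / M) * (x c / M))) =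
        3 * M * (x a * x b + x b * x c + x c * x a) - 6 * (x a * x b * x c) := by
      field_simp
      ring
    linarith

/-- Multiply the first-order bound at `v` by `3 * M - 2 * x v ≥ 0` and sum over the support. After
exchanging sums, each edge contributes at most `3 * M ^ 3`. -/
theorem lagrangian_mul_le_card_mul (G : RGraph 3 n) {x : Fin n → ℝ}
    (hx : x ∈ stdSimplex ℝ (Fin n)) (hopt : G.weight x = G.lagrangian) {M : ℝ} (hM : 0 < M)
    (hxM : ∀ i, x i ≤ M) :
    G.lagrangian * (3 * (support x).card * M - 2) ≤ G.edges.card * M ^ 3 := by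
  have h1 : ∑ v ∈ support x, (3 * M - 2 * x v) * (3 * G.lagrangian) ≤
      ∑ v ∈ support x, (3 * M - 2 * x v) * G.linkWeight x v := by
    refine Finset.sum_le_sum fun v hv => mul_le_mul_of_nonneg_left
      (G.three_mul_lagrangian_le_linkWeight hx hopt (mem_support.1 hv)) ?_
    linarith [hxM v]
  have h2 : ∑ v ∈ support x, (3 * M - 2 * x v) * G.linkWeight x v =
      ∑ e ∈ G.edges, ∑ v ∈ e with 0 < x v, (3 * M - 2 * x v) * ∏ i ∈ e.erase v, x i := by
    simp only [linkWeight, Finset.mul_sum]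
    refine Finset.sum_comm' fun v e => ?_
    simp only [mem_support, Finset.mem_filter]
    tauto
  have h3 : ∑ e ∈ G.edges, ∑ v ∈ e with 0 < x v, (3 * M - 2 * x v) * ∏ i ∈ e.erase v, x i ≤
      G.edges.card * (3 * M ^ 3) := by
    rw [← nsmul_eq_mul]
    exact Finset.sum_le_card_nsmul _ _ _ fun e he =>
      sum_weighted_links_le hx.1 hM hxM (G.card_of_mem e he)
  have h4 : ∑ v ∈ support x, (3 * M - 2 * x v) * (3 * G.lagrangian) =
      ((support x).card * (3 * M) - 2) * (3 * G.lagrangian) := by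
    rw [← Finset.sum_mul, Finset.sum_sub_distrib, Finset.sum_const, ← Finset.mul_sum,
      sum_support hx, nsmul_eq_mul, mul_one]
  linarith

/-! ### Bounding the support of an optimal weighting -/

/-- If `T < 1`, then `q + 2 ≤ k ≤ (q + 3) * T ^ 2` keeps `1 - T` below `1 / (q + 3)`. This
contradicts `hA` through `T ^ 3 - 3 * T + 2 = (1 - T) ^ 2 * (T + 2)`. -/
theorem one_le_of_cubic {q k T : ℝ} (hq : 4 ≤ q) (hk : q + 2 ≤ k) (hT0 : 0 < T) (hkT : q ≤ k * T)
    (hA : 3 * k * T - 2 * q ≤ (q + 3) * T ^ 3) : 1 ≤ T := by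
  by_contra! hT
  have h1 : k ≤ (q + 3) * T ^ 2 := by
    have : T * k ≤ T * ((q + 3) * T ^ 2) := by nlinarith
    exact le_of_mul_le_mul_left this hT0
  have h2 : (q + 3) * (1 - T) ≤ 1 := by nlinarith [mul_pos hT0 (sub_pos.2 hT)]
  have h3 : (q + 3) * (1 - T) ^ 2 ≤ 1 - T := by nlinarith
  have h4 : (q + 3) * (1 - T) ^ 2 * (T + 2) ≤ (1 - T) * (T + 2) :=
    mul_le_mul_of_nonneg_right h3 (by linarith)
  nlinarith

/-- Here `k` is the support size and `T` is `q` times the largest weight. `hB` forces `T` close to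
1, while `hA` needs `T` well above 1 once `k ≥ q + 2`. -/
theorem false_of_support_bounds {q k T : ℝ} (hq : 4 ≤ q) (hk : q + 2 ≤ k) (hT0 : 0 < T)
    (hTq : T ≤ q) (hkT : q ≤ k * T) (hA : 3 * k * T - 2 * q ≤ (q + 3) * T ^ 3)
    (hB : (q - 1) * (q - 2) * (k - 1) ≤ (q - T) ^ 2 * (k - 2)) : False := by
  have hT1 := one_le_of_cubic hq hk hT0 hkT hA
  obtain ⟨δ, rfl⟩ : ∃ δ, T = 1 + δ := ⟨T - 1, by ring⟩
  obtain ⟨s, rfl⟩ : ∃ s, q = s + 1 := ⟨q - 1, by ring⟩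
  obtain ⟨j, rfl⟩ : ∃ j, k = s + 2 + j := ⟨k - s - 2, by ring⟩
  have hδ : 0 ≤ δ := by linarith
  have hs : 3 ≤ s := by linarith
  have hj : 1 ≤ j := by linarith
  have hA' : 3 * j * (1 + δ) ≤ 6 * δ + (s + 4) * δ ^ 2 * (3 + δ) := by linear_combination hA
  have hB' : δ * (2 * s - δ) * (s + j) ≤ s * (1 + j) := by linear_combination hB
  have hδ1 : δ < 1 := by
    by_contra! h
    have h1 : (s - δ) ^ 2 ≤ (s - 1) ^ 2 := by
      apply sq_le_sq'
      · linarith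
      · linarith
    have h2 : (s - δ) ^ 2 * (s + j) ≤ (s - 1) ^ 2 * (s + j) :=
      mul_le_mul_of_nonneg_right h1 (by linarith)
    nlinarith [mul_pos (show 0 < s - 1 by linarith) (show 0 < s + j by linarith),
      mul_pos (show 0 < s - 1 by linarith) (show 0 < s by linarith)]
  have hδ6 : δ ≤ 3 / 5 := by
    have h1 : δ * (2 * s - δ) * (s + j) ≤ s * (s + j) :=
      hB'.trans (mul_le_mul_of_nonneg_left (by linarith) (by linarith))
    have h2 : δ * (2 * s - δ) ≤ s := le_of_mul_le_mul_right h1 (by linarith)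
    nlinarith
  have hδj : 9 / 5 * δ * (s + j) ≤ 1 + j := by
    have h1 : s * (9 / 5 * δ * (s + j)) ≤ s * (1 + j) := by
      refine le_trans ?_ hB'
      have h2 : s * (9 / 5 * δ) ≤ δ * (2 * s - δ) := by nlinarith
      have h3 := mul_le_mul_of_nonneg_right h2 (show 0 ≤ s + j by linarith)
      linarith
    exact le_of_mul_le_mul_left h1 (by linarith)
  -- `35 / 36 = 5 / 9 * (7 / 4)`, since `s + 4 ≤ 7 / 4 * (s + j)` for `s ≥ 3`, `j ≥ 1`.
  have h1 : (s + 4) * δ ≤ 35 / 36 * (1 + j) := by nlinarith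
  have h2 : (s + 4) * δ ^ 2 * (3 + δ) ≤ 7 / 2 * (1 + j) * δ := by
    have h3 : (s + 4) * δ ^ 2 ≤ 35 / 36 * (1 + j) * δ := by nlinarith
    have h4 : (s + 4) * δ ^ 2 * (3 + δ) ≤ 35 / 36 * (1 + j) * δ * (3 + δ) :=
      mul_le_mul_of_nonneg_right h3 (by linarith)
    have h5 : 0 ≤ (1 + j) * δ := by positivity
    nlinarith
  have h3 : 3 * j ≤ 19 / 2 * δ + 1 / 2 * j * δ := by linarith
  -- From here `h3` and `h4` alternately sharpen the upper bounds on `j` and `δ` until `j ≥ 1`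
  -- fails.
  have h4 : 9 / 5 * δ * (3 + j) ≤ 1 + j := by nlinarith
  have h5 : j ≤ 19 / 9 := by nlinarith
  have h6 : δ ≤ 7 / 20 := by nlinarith
  have h7 : j ≤ 6 / 5 := by nlinarith
  have h8 : δ ≤ 3 / 10 := by nlinarith
  nlinarith

theorem choose_three_cast (q : ℕ) :
    6 * ((q.choose 3 : ℕ) : ℝ) = q * (q - 1) * (q - 2) := by
  rw [Nat.cast_choose_eq_descPochhammer_div]
  simp [descPochhammer_succ_right, Nat.factorial]
  ring

/-- The uniform weighting bounds the Lagrangian of a complete 3-graph from below. -/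
theorem choose_le_lagrangian_complete {q : ℕ} (hq : 0 < q) :
    (q.choose 3 : ℝ) ≤ q ^ 3 * (complete 3 q).lagrangian := by
  have hq' : (0 : ℝ) < q := by exact_mod_cast hq
  have hx : (fun _ => (q : ℝ)⁻¹) ∈ stdSimplex ℝ (Fin q) :=
    ⟨fun _ => by positivity, by simp [hq'.ne']⟩
  have h := (complete 3 q).weight_le_lagrangian hx
  have hw : (complete 3 q).weight (fun _ => (q : ℝ)⁻¹) = q.choose 3 * ((q : ℝ)⁻¹) ^ 3 := by
    unfold weight
    rw [Finset.sum_congr rfl (g := fun _ => ((q : ℝ)⁻¹) ^ 3)]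
    · simp [complete]
    · intro e he
      rw [Finset.prod_const, (complete 3 q).card_of_mem e he]
  rw [hw, inv_pow, ← div_eq_mul_inv, div_le_iff₀ (by positivity)] at h
  linarith

/-- An optimal weighting of a 3-graph with few edges and large Lagrangian has small support. -/
theorem card_support_le (G : RGraph 3 n) {q : ℕ} (hq : 4 ≤ q)
    (hm : G.edges.card ≤ q.choose 3 + (q - 1).choose 2)
    (hL : (complete 3 q).lagrangian ≤ G.lagrangian) {x : Fin n → ℝ}
    (hx : x ∈ stdSimplex ℝ (Fin n)) (hopt : G.weight x = G.lagrangian) :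
    (support x).card ≤ q + 1 := by
  by_contra! hk
  have hq4 : (4 : ℝ) ≤ q := by exact_mod_cast hq
  have hne : (Finset.univ : Finset (Fin n)).Nonempty := by
    obtain ⟨i, -⟩ := Finset.card_pos.1 (show 0 < (support x).card by omega)
    exact ⟨i, Finset.mem_univ i⟩
  obtain ⟨v, -, hv⟩ := Finset.exists_max_image Finset.univ x hne
  replace hv : ∀ i, x i ≤ x v := fun i => hv i (Finset.mem_univ i)
  obtain ⟨k, hkdef⟩ : ∃ k : ℝ, k = ((support x).card : ℝ) := ⟨_, rfl⟩
  have hk' : (q : ℝ) + 2 ≤ k := by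
    rw [hkdef]
    exact_mod_cast hk
  have hkM : 1 ≤ k * x v := by
    rw [← sum_support hx, hkdef, ← nsmul_eq_mul]
    exact Finset.sum_le_card_nsmul _ _ _ fun i _ => hv i
  have hM : 0 < x v := by
    by_contra! h
    nlinarith
  have hM1 : x v ≤ 1 := by
    rw [← hx.2]
    exact Finset.single_le_sum (fun i _ => hx.1 i) (Finset.mem_univ v)
  have hA := G.lagrangian_mul_le_card_mul hx hopt hM hv
  have hB := G.linkWeight_le hx hM
  have hB2 := G.three_mul_lagrangian_le_linkWeight hx hopt hM
  rw [← hkdef] at hA hB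
  have hLq := choose_le_lagrangian_complete (show 0 < q by omega)
  have hc3 := choose_three_cast q
  have hc2 : 2 * (((q - 1).choose 2 : ℕ) : ℝ) = (q - 1) * (q - 2) := by
    rw [Nat.cast_choose_two, Nat.cast_sub (by omega)]
    push_cast
    ring
  have hm' : 6 * (G.edges.card : ℝ) ≤ (q - 1) * (q - 2) * (q + 3) := by
    have : (G.edges.card : ℝ) ≤ (q.choose 3 : ℕ) + ((q - 1).choose 2 : ℕ) := by exact_mod_cast hm
    linarith
  have hp : 0 < ((q : ℝ) - 1) * (q - 2) := mul_pos (by linarith) (by linarith)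
  have hlam : ((q : ℝ) - 1) * (q - 2) ≤ 6 * q ^ 2 * G.lagrangian := by
    have h1 : (q : ℝ) ^ 3 * (complete 3 q).lagrangian ≤ q ^ 3 * G.lagrangian :=
      mul_le_mul_of_nonneg_left hL (by positivity)
    have h2 : (q : ℝ) * ((q - 1) * (q - 2)) ≤ q * (6 * q ^ 2 * G.lagrangian) := by linarith
    exact le_of_mul_le_mul_left h2 (by linarith)
  refine false_of_support_bounds (q := q) (k := k) (T := q * x v) hq4 hk' (by positivity)
    (by nlinarith) (by nlinarith) ?_ ?_
  · have h1 : ((q : ℝ) - 1) * (q - 2) * (3 * k * x v - 2) ≤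
        6 * q ^ 2 * G.lagrangian * (3 * k * x v - 2) :=
      mul_le_mul_of_nonneg_right hlam (by linarith)
    have h2 : 6 * q ^ 2 * (G.lagrangian * (3 * k * x v - 2)) ≤
        6 * q ^ 2 * (G.edges.card * x v ^ 3) := mul_le_mul_of_nonneg_left hA (by positivity)
    have h3 : q ^ 2 * x v ^ 3 * (6 * (G.edges.card : ℝ)) ≤
        q ^ 2 * x v ^ 3 * ((q - 1) * (q - 2) * (q + 3)) :=
      mul_le_mul_of_nonneg_left hm' (by positivity)
    have h4 : ((q : ℝ) - 1) * (q - 2) * (3 * k * x v - 2) ≤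
        ((q : ℝ) - 1) * (q - 2) * (q ^ 2 * x v ^ 3 * (q + 3)) := by linarith
    have h5 := mul_le_mul_of_nonneg_left (le_of_mul_le_mul_left h4 hp)
      (show (0 : ℝ) ≤ q by linarith)
    linear_combination h5
  · have h1 : ((q : ℝ) - 1) * (q - 2) * (k - 1) ≤ 6 * q ^ 2 * G.lagrangian * (k - 1) :=
      mul_le_mul_of_nonneg_right hlam (by linarith)
    have h2 : 2 * (k - 1) * (3 * G.lagrangian) ≤ (1 - x v) ^ 2 * (k - 2) :=
      (mul_le_mul_of_nonneg_left hB2 (by linarith)).trans hB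
    have h3 := mul_le_mul_of_nonneg_left h2 (show (0 : ℝ) ≤ q ^ 2 by positivity)
    linear_combination h1 + h3

end RGraph

/-! ### Exchanging non-edges for the triples of the last four vertices -/

namespace RGraph

/-- The heavy part `A` of `K \ R` is paid for by `B`. The rest of `K \ R` weighs at most `τ` per
element, so any other elements of `R \ K` pay for it. -/
theorem exists_superset_sum_le {α : Type*} [DecidableEq α] (w : α → ℝ) {K R A B : Finset α}
    (hcard : K.card ≤ R.card) (hA : A ⊆ K \ R) (hB : B ⊆ R \ K) (hAB : A.card = B.card)
    (hw : ∑ s ∈ A, w s ≤ ∑ s ∈ B, w s) {τ : ℝ} (hK : ∀ s ∈ K \ R, s ∉ A → w s ≤ τ)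
    (hR : ∀ s ∈ R \ K, τ ≤ w s) :
    ∃ F, K ⊆ F ∧ F ⊆ R ∪ K ∧ F.card = R.card ∧ ∑ s ∈ F, w s ≤ ∑ s ∈ R, w s := by
  have hle : (K \ R).card ≤ (R \ K).card := by
    have h1 := Finset.card_sdiff_add_card_inter K R
    have h2 := Finset.card_sdiff_add_card_inter R K
    rw [Finset.inter_comm] at h2
    omega
  obtain ⟨Q, hBQ, hQR, hQ⟩ := Finset.exists_subsuperset_card_eq hB
    (hAB ▸ Finset.card_le_card hA) hle
  have hcardQ : ((K \ R) \ A).card = (Q \ B).card := by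
    rw [Finset.card_sdiff_of_subset hA, Finset.card_sdiff_of_subset hBQ, hQ, hAB]
  have hsum : ∑ s ∈ K \ R, w s ≤ ∑ s ∈ Q, w s := by
    rw [← Finset.sum_sdiff hA, ← Finset.sum_sdiff hBQ]
    refine add_le_add ?_ hw
    calc ∑ s ∈ (K \ R) \ A, w s ≤ ((K \ R) \ A).card • τ :=
          Finset.sum_le_card_nsmul _ _ _ fun s hs =>
            hK s (Finset.mem_sdiff.1 hs).1 (Finset.mem_sdiff.1 hs).2
      _ = (Q \ B).card • τ := by rw [hcardQ]
      _ ≤ ∑ s ∈ Q \ B, w s :=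
          Finset.card_nsmul_le_sum _ _ _ fun s hs => hR s (hQR (Finset.mem_sdiff.1 hs).1)
  have hQR' : Q ⊆ R := hQR.trans Finset.sdiff_subset
  have hdisj : Disjoint (R \ Q) (K \ R) := by
    rw [Finset.disjoint_left]
    intro s hs hs'
    exact (Finset.mem_sdiff.1 hs').2 (Finset.mem_sdiff.1 hs).1
  refine ⟨(R \ Q) ∪ (K \ R), fun s hs => ?_, ?_, ?_, ?_⟩
  · by_cases hsR : s ∈ R
    · refine Finset.mem_union_left _ (Finset.mem_sdiff.2 ⟨hsR, fun hsQ => ?_⟩)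
      exact (Finset.mem_sdiff.1 (hQR hsQ)).2 hs
    · exact Finset.mem_union_right _ (Finset.mem_sdiff.2 ⟨hs, hsR⟩)
  · exact Finset.union_subset_union Finset.sdiff_subset Finset.sdiff_subset
  · rw [Finset.card_union_of_disjoint hdisj, Finset.card_sdiff_of_subset hQR', ← hQ]
    have := Finset.card_le_card hQR'
    omega
  · rw [Finset.sum_union hdisj, ← Finset.sum_sdiff hQR']
    linarith

/-- Only `p` and `q` may exceed the threshold `τ`; they are paid for by `f` and `g`. If `f = g`, one
element cannot pay twice, and `hfg` supplies a second payer. -/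
theorem exists_superset_sum_le_of_pair {α : Type*} [DecidableEq α] (w : α → ℝ) {K R : Finset α}
    (hcard : K.card ≤ R.card) {p q f g : α} (hp : p ∈ K) (hq : q ∈ K) (hpq : p ≠ q) (hf : f ∈ R)
    (hg : g ∈ R) (hfK : p ∉ R → f ∉ K) (hgK : q ∉ R → g ∉ K) (hpf : w p ≤ w f) (hqg : w q ≤ w g)
    (hfg : f = g → ∀ h ∈ R \ K, w p + w q ≤ w f + w h) {τ : ℝ}
    (hK : ∀ s ∈ K, s ≠ p → s ≠ q → w s ≤ τ) (hR : ∀ s ∈ R \ K, τ ≤ w s) :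
    ∃ F, K ⊆ F ∧ F ⊆ R ∪ K ∧ F.card = R.card ∧ ∑ s ∈ F, w s ≤ ∑ s ∈ R, w s := by
  suffices h : ∃ S T : Finset α, S ⊆ K \ R ∧ T ⊆ R \ K ∧ S.card = T.card ∧
      ∑ e ∈ S, w e ≤ ∑ e ∈ T, w e ∧ (p ∉ R → p ∈ S) ∧ (q ∉ R → q ∈ S) by
    obtain ⟨S, T, hS, hT, hST, hsum, h1, h2⟩ := h
    refine exists_superset_sum_le w hcard hS hT hST hsum (fun e he heS => ?_) hR
    rw [Finset.mem_sdiff] at he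
    refine hK e he.1 ?_ ?_
    · rintro rfl
      exact heS (h1 he.2)
    · rintro rfl
      exact heS (h2 he.2)
  by_cases h1 : p ∈ R <;> by_cases h2 : q ∈ R
  · exact ⟨∅, ∅, by simp, by simp, rfl, le_rfl, fun h => absurd h1 h, fun h => absurd h2 h⟩
  · exact ⟨{q}, {g}, by simp [hq, h2], by simp [hg, hgK h2], rfl, by simpa using hqg,
      fun h => absurd h1 h, by simp⟩
  · exact ⟨{p}, {f}, by simp [hp, h1], by simp [hf, hfK h1], rfl, by simpa using hpf,
      by simp, fun h => absurd h2 h⟩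
  · have hS : ({p, q} : Finset α) ⊆ K \ R := by
      simp [Finset.insert_subset_iff, hp, hq, h1, h2]
    by_cases hfg' : f = g
    · have hle : 1 < (R \ K).card := by
        have h3 := Finset.card_sdiff_add_card_inter K R
        have h4 := Finset.card_sdiff_add_card_inter R K
        have h5 := Finset.card_le_card hS
        rw [Finset.inter_comm] at h4
        rw [Finset.card_pair hpq] at h5
        omega
      obtain ⟨h, hh, hhf⟩ := Finset.exists_mem_ne hle f
      refine ⟨{p, q}, {f, h}, hS, ?_, ?_, ?_, by simp, by simp⟩
      · rw [Finset.insert_subset_iff, Finset.singleton_subset_iff]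
        exact ⟨Finset.mem_sdiff.2 ⟨hf, hfK h1⟩, hh⟩
      · rw [Finset.card_pair hpq, Finset.card_pair hhf.symm]
      · rw [Finset.sum_pair hpq, Finset.sum_pair hhf.symm]
        exact hfg hfg' h hh
    · refine ⟨{p, q}, {f, g}, hS, ?_, ?_, ?_, by simp, by simp⟩
      · rw [Finset.insert_subset_iff, Finset.singleton_subset_iff]
        exact ⟨Finset.mem_sdiff.2 ⟨hf, hfK h1⟩, Finset.mem_sdiff.2 ⟨hg, hgK h2⟩⟩
      · rw [Finset.card_pair hpq, Finset.card_pair hfg']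
      · rw [Finset.sum_pair hpq, Finset.sum_pair hfg']
        exact add_le_add hpf hqg

variable {l : ℕ}

theorem exists_sorted_triple {e : Finset (Fin l)} (he : e.card = 3) :
    ∃ i j k, i < j ∧ j < k ∧ e = {i, j, k} := by
  refine ⟨e.orderEmbOfFin he 0, e.orderEmbOfFin he 1, e.orderEmbOfFin he 2, by simp, by simp, ?_⟩
  conv_lhs => rw [← Finset.image_orderEmbOfFin_univ e he]
  simp [Fin.univ_succ]

theorem prod_triple {i j k : Fin l} (hij : i < j) (hjk : j < k) (y : Fin l → ℝ) :
    ∏ v ∈ ({i, j, k} : Finset (Fin l)), y v = y i * y j * y k := by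
  rw [Finset.prod_insert (by simp [hij.ne, (hij.trans hjk).ne]), Finset.prod_pair hjk.ne, mul_assoc]

/-- The last four vertices. -/
def lastFour (l : ℕ) : Finset (Fin l) := {v | l ≤ v + 4}

theorem mem_lastFour {v : Fin l} : v ∈ lastFour l ↔ l ≤ v + 4 := by simp [lastFour]

theorem card_lastFour (hl : 4 ≤ l) : (lastFour l).card = 4 := by
  obtain ⟨s, rfl⟩ := Nat.exists_eq_add_of_le' hl
  have : lastFour (s + 4) = {⟨s, by omega⟩, ⟨s + 1, by omega⟩, ⟨s + 2, by omega⟩,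
      ⟨s + 3, by omega⟩} := by
    ext v
    simp only [mem_lastFour, Finset.mem_insert, Finset.mem_singleton, Fin.ext_iff]
    have := v.2
    omega
  rw [this]
  simp [Fin.ext_iff]

theorem four_weights_exchange {a b c d e : ℝ} (hd : 0 ≤ d) (hdc : d ≤ c) (hcb : c ≤ b)
    (hba : b ≤ a) (hae : a ≤ e) : a * b * c + a * b * d ≤ e * a * b + e * c * d := by
  have hc : 0 ≤ c := hd.trans hdc
  have hb : 0 ≤ b := hc.trans hcb
  have ha : 0 ≤ a := hb.trans hba
  have hab : 0 ≤ a * b := mul_nonneg ha hb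
  rcases le_total (a * b) (e * c) with h | h
  · nlinarith [mul_le_mul_of_nonneg_left h hd, mul_nonneg hab (show 0 ≤ e - c by linarith)]
  · have h1 : d * (a * b - e * c) ≤ c * (a * b - e * c) :=
      mul_le_mul_of_nonneg_right hdc (by linarith)
    have h2 : a * (a * b + c ^ 2) ≤ e * (a * b + c ^ 2) :=
      mul_le_mul_of_nonneg_right hae (by positivity)
    have h3 : 0 ≤ a * (b - c) ^ 2 := by positivity
    have h4 : 0 ≤ a * (b * (a - b)) := mul_nonneg ha (mul_nonneg hb (by linarith))
    linarith

theorem mul_mul_le_mul_mul {a b c a' b' c' : ℝ} (ha : 0 ≤ a) (hb : 0 ≤ b) (hc : 0 ≤ c)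
    (h1 : a ≤ a') (h2 : b ≤ b') (h3 : c ≤ c') : a * b * c ≤ a' * b' * c' :=
  mul_le_mul (mul_le_mul h1 h2 hb (ha.trans h1)) h3 hc
    (mul_nonneg (ha.trans h1) (hb.trans h2))

/-- Let `E, A, B, C, D` be the last five vertices. A triple outside the block weighs at least `ECD`,
so only `ABC` and `ABD` can be too heavy. A non-edge avoiding `D` pays for `ABC`, one avoiding `C`
for `ABD`. If they coincide, that non-edge weighs at least `EAB`, and `four_weights_exchange` covers
both with one more non-edge. -/
theorem exists_superset_lastFour {y : Fin l → ℝ} (hl : 5 ≤ l) (hy : Antitone y)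
    (hy0 : ∀ i, 0 ≤ y i) {R : Finset (Finset (Fin l))} (hR : ∀ e ∈ R, e.card = 3)
    (hR4 : 4 ≤ R.card) (hcommon : ∀ v, ∃ e ∈ R, v ∉ e) :
    ∃ F, (lastFour l).powersetCard 3 ⊆ F ∧ (∀ e ∈ F, e.card = 3) ∧ F.card = R.card ∧
      ∑ e ∈ F, ∏ i ∈ e, y i ≤ ∑ e ∈ R, ∏ i ∈ e, y i := by
  obtain ⟨s, rfl⟩ := Nat.exists_eq_add_of_le' hl
  let E : Fin (s + 5) := ⟨s, by omega⟩
  let A : Fin (s + 5) := ⟨s + 1, by omega⟩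
  let B : Fin (s + 5) := ⟨s + 2, by omega⟩
  let C : Fin (s + 5) := ⟨s + 3, by omega⟩
  let D : Fin (s + 5) := ⟨s + 4, by omega⟩
  have hEA : y A ≤ y E := hy (by simp [E, A])
  have hAB : y B ≤ y A := hy (by simp [A, B])
  have hBC : y C ≤ y B := hy (by simp [B, C])
  have hCD : y D ≤ y C := hy (by simp [C, D])
  have lAB : A < B := by simp [A, B]
  have lBC : B < C := by simp [B, C]
  have lCD : C < D := by simp [C, D]
  have hw : ∀ e : Finset (Fin (s + 5)), e.card = 3 →
      ((D ∉ e → y A * y B * y C ≤ ∏ i ∈ e, y i) ∧ (C ∉ e → y A * y B * y D ≤ ∏ i ∈ e, y i) ∧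
      (e ∉ (lastFour (s + 5)).powersetCard 3 → y E * y C * y D ≤ ∏ i ∈ e, y i) ∧
      (C ∉ e → D ∉ e → y E * y A * y B ≤ ∏ i ∈ e, y i)) := by
    intro e he
    obtain ⟨i, j, k, hij, hjk, rfl⟩ := exists_sorted_triple he
    rw [prod_triple hij hjk]
    have hk := k.2
    rw [Fin.lt_def] at hij hjk
    refine ⟨fun h => ?_, fun h => ?_, fun h => ?_, fun h h' => ?_⟩
    · simp only [Finset.mem_insert, Finset.mem_singleton, Fin.ext_iff, D] at h
      exact mul_mul_le_mul_mul (hy0 _) (hy0 _) (hy0 _) (hy (Fin.le_def.2 (by simp [A]; omega)))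
        (hy (Fin.le_def.2 (by simp [B]; omega))) (hy (Fin.le_def.2 (by simp [C]; omega)))
    · simp only [Finset.mem_insert, Finset.mem_singleton, Fin.ext_iff, C] at h
      exact mul_mul_le_mul_mul (hy0 _) (hy0 _) (hy0 _) (hy (Fin.le_def.2 (by simp [A]; omega)))
        (hy (Fin.le_def.2 (by simp [B]; omega))) (hy (Fin.le_def.2 (by simp [D]; omega)))
    · have hi : (i : ℕ) ≤ s := by
        by_contra! hi
        refine h (Finset.mem_powersetCard.2 ⟨fun v hv => ?_, he⟩)
        simp only [Finset.mem_insert, Finset.mem_singleton, Fin.ext_iff] at hv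
        rw [mem_lastFour]
        omega
      exact mul_mul_le_mul_mul (hy0 _) (hy0 _) (hy0 _) (hy (Fin.le_def.2 (by simpa [E] using hi)))
        (hy (Fin.le_def.2 (by simp [C]; omega))) (hy (Fin.le_def.2 (by simp [D]; omega)))
    · simp only [Finset.mem_insert, Finset.mem_singleton, Fin.ext_iff, C, D] at h h'
      exact mul_mul_le_mul_mul (hy0 _) (hy0 _) (hy0 _) (hy (Fin.le_def.2 (by simp [E]; omega)))
        (hy (Fin.le_def.2 (by simp [A]; omega))) (hy (Fin.le_def.2 (by simp [B]; omega)))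
  set K := (lastFour (s + 5)).powersetCard 3 with hKdef
  have hKcases : ∀ e ∈ K, e = {A, B, C} ∨ e = {A, B, D} ∨ e = {A, C, D} ∨ e = {B, C, D} := by
    intro e he
    rw [hKdef, Finset.mem_powersetCard] at he
    obtain ⟨i, j, k, hij, hjk, rfl⟩ := exists_sorted_triple he.2
    have hi := mem_lastFour.1 (he.1 (show i ∈ ({i, j, k} : Finset _) by simp))
    have hk := k.2
    rw [Fin.lt_def] at hij hjk
    have : (i = A ∧ j = B ∧ k = C) ∨ (i = A ∧ j = B ∧ k = D) ∨ (i = A ∧ j = C ∧ k = D) ∨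
        (i = B ∧ j = C ∧ k = D) := by
      simp only [Fin.ext_iff, A, B, C, D]
      omega
    rcases this with ⟨rfl, rfl, rfl⟩ | ⟨rfl, rfl, rfl⟩ | ⟨rfl, rfl, rfl⟩ | ⟨rfl, rfl, rfl⟩ <;> simp
  have hKcard : K.card = 4 := by
    rw [hKdef, Finset.card_powersetCard, card_lastFour (by omega)]
    rfl
  have hsmall : ∀ e ∈ K, e ≠ {A, B, C} → e ≠ {A, B, D} → ∏ i ∈ e, y i ≤ y E * y C * y D := by
    intro e he h1 h2
    rcases hKcases e he with rfl | rfl | rfl | rfl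
    · exact absurd rfl h1
    · exact absurd rfl h2
    · rw [prod_triple (lAB.trans lBC) lCD]
      exact mul_mul_le_mul_mul (hy0 _) (hy0 _) (hy0 _) hEA le_rfl le_rfl
    · rw [prod_triple lBC lCD]
      exact mul_mul_le_mul_mul (hy0 _) (hy0 _) (hy0 _) (hAB.trans hEA) le_rfl le_rfl
  have hlarge : ∀ e ∈ R \ K, y E * y C * y D ≤ ∏ i ∈ e, y i := fun e he =>
    (hw e (hR e (Finset.mem_sdiff.1 he).1)).2.2.1 (Finset.mem_sdiff.1 he).2
  have hABC : ({A, B, C} : Finset (Fin (s + 5))) ∈ K := by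
    rw [hKdef, Finset.mem_powersetCard]
    refine ⟨fun v hv => ?_, by simp [A, B, C, Fin.ext_iff]⟩
    simp only [Finset.mem_insert, Finset.mem_singleton, Fin.ext_iff, A, B, C] at hv
    rw [mem_lastFour]
    omega
  have hABD : ({A, B, D} : Finset (Fin (s + 5))) ∈ K := by
    rw [hKdef, Finset.mem_powersetCard]
    refine ⟨fun v hv => ?_, by simp [A, B, D, Fin.ext_iff]⟩
    simp only [Finset.mem_insert, Finset.mem_singleton, Fin.ext_iff, A, B, D] at hv
    rw [mem_lastFour]
    omega
  have hneK : ({A, B, C} : Finset (Fin (s + 5))) ≠ {A, B, D} := by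
    intro h
    have : D ∈ ({A, B, C} : Finset (Fin (s + 5))) := by rw [h]; simp
    simp [A, B, C, D, Fin.ext_iff] at this
  have hpABC : ∏ i ∈ ({A, B, C} : Finset (Fin (s + 5))), y i = y A * y B * y C :=
    prod_triple lAB lBC y
  have hpABD : ∏ i ∈ ({A, B, D} : Finset (Fin (s + 5))), y i = y A * y B * y D :=
    prod_triple lAB (lBC.trans lCD) y
  obtain ⟨f, hfR, hfD⟩ := hcommon D
  obtain ⟨g, hgR, hgC⟩ := hcommon C
  have hfK : ({A, B, C} : Finset (Fin (s + 5))) ∉ R → f ∉ K := by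
    intro h hf
    rcases hKcases f hf with rfl | rfl | rfl | rfl
    · exact h hfR
    all_goals simp at hfD
  have hgK : ({A, B, D} : Finset (Fin (s + 5))) ∉ R → g ∉ K := by
    intro h hg
    rcases hKcases g hg with rfl | rfl | rfl | rfl
    · simp at hgC
    · exact h hgR
    all_goals simp at hgC
  obtain ⟨F, hKF, hF, hFc, hFs⟩ := exists_superset_sum_le_of_pair (fun e => ∏ i ∈ e, y i)
    (hKcard.trans_le hR4) hABC hABD hneK hfR hgR hfK hgK
    (hpABC.trans_le ((hw f (hR f hfR)).1 hfD)) (hpABD.trans_le ((hw g (hR g hgR)).2.1 hgC))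
    (fun hfg h hh => by
      subst hfg
      simp only [hpABC, hpABD]
      refine (four_weights_exchange (hy0 D) hCD hBC hAB hEA).trans ?_
      exact add_le_add ((hw f (hR f hfR)).2.2.2 hgC hfD) (hlarge h hh)) hsmall hlarge
  refine ⟨F, hKF, fun e he => ?_, hFc, hFs⟩
  rcases Finset.mem_union.1 (hF he) with h | h
  · exact hR e h
  · exact (Finset.mem_powersetCard.1 h).2

end RGraph

/-! ### Up-closed families of non-edges, and transfer to `l` vertices -/

namespace RGraph

variable {l n : ℕ}

/-- Among the admissible families take one with the largest sum of vertex labels. A violation of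
up-closure would allow a swap that raises this sum, does not raise the weight, and spares the block,
which is itself up-closed. -/
theorem exists_upper_family {y : Fin l → ℝ} (hl : 5 ≤ l) (hy : Antitone y) (hy0 : ∀ i, 0 ≤ y i)
    {R : Finset (Finset (Fin l))} (hR : ∀ e ∈ R, e.card = 3) {N : ℕ} (hN4 : 4 ≤ N)
    (hN : N ≤ R.card) (hcommon : ∀ v, ∃ e ∈ R, v ∉ e) :
    ∃ F, (lastFour l).powersetCard 3 ⊆ F ∧ (∀ e ∈ F, e.card = 3) ∧ F.card = N ∧
      ∑ e ∈ F, ∏ i ∈ e, y i ≤ ∑ e ∈ R, ∏ i ∈ e, y i ∧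
      ∀ i j : Fin 3 → Fin l, StrictMono i → StrictMono j → (∀ p, i p ≤ j p) →
        Finset.univ.image i ∈ F → Finset.univ.image j ∈ F := by
  classical
  have hnn : ∀ e : Finset (Fin l), 0 ≤ ∏ i ∈ e, y i := fun e =>
    Finset.prod_nonneg fun i _ => hy0 i
  let 𝓕 : Finset (Finset (Finset (Fin l))) :=
    {F | (lastFour l).powersetCard 3 ⊆ F ∧ (∀ e ∈ F, e.card = 3) ∧ F.card = N ∧
      ∑ e ∈ F, ∏ i ∈ e, y i ≤ ∑ e ∈ R, ∏ i ∈ e, y i}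
  have hne : 𝓕.Nonempty := by
    obtain ⟨F₀, hK, hF₀, hc, hs⟩ := exists_superset_lastFour hl hy hy0 hR (hN4.trans hN) hcommon
    have hKc : ((lastFour l).powersetCard 3).card = 4 := by
      rw [Finset.card_powersetCard, card_lastFour (by omega)]
      rfl
    obtain ⟨F, hKF, hFF, hFc⟩ := Finset.exists_subsuperset_card_eq hK (hKc.trans_le hN4)
      (hc ▸ hN)
    refine ⟨F, Finset.mem_filter.2 ⟨Finset.mem_univ _, hKF, fun e he => hF₀ e (hFF he), hFc, ?_⟩⟩
    exact (Finset.sum_le_sum_of_subset_of_nonneg hFF fun e _ _ => hnn e).trans hs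
  obtain ⟨F, hF, hmax⟩ := Finset.exists_max_image 𝓕 (fun F => ∑ e ∈ F, ∑ v ∈ e, (v : ℕ)) hne
  obtain ⟨-, hK, h3, hc, hs⟩ := Finset.mem_filter.1 hF
  refine ⟨F, hK, h3, hc, hs, fun i j hi hj hij hiF => ?_⟩
  by_contra hjF
  have hiK : Finset.univ.image i ∉ (lastFour l).powersetCard 3 := by
    intro h
    refine hjF (hK (Finset.mem_powersetCard.2 ⟨fun v hv => ?_, ?_⟩))
    · obtain ⟨p, -, rfl⟩ := Finset.mem_image.1 hv
      have h1 := mem_lastFour.1 ((Finset.mem_powersetCard.1 h).1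
        (Finset.mem_image_of_mem i (Finset.mem_univ p)))
      have h2 := Fin.le_def.1 (hij p)
      rw [mem_lastFour]
      omega
    · rw [Finset.card_image_of_injective _ hj.injective]
      simp
  have hjE : Finset.univ.image j ∉ F.erase (Finset.univ.image i) := fun h =>
    hjF (Finset.mem_of_mem_erase h)
  have hmem : insert (Finset.univ.image j) (F.erase (Finset.univ.image i)) ∈ 𝓕 := by
    refine Finset.mem_filter.2 ⟨Finset.mem_univ _, fun e he => ?_, fun e he => ?_, ?_, ?_⟩
    · refine Finset.mem_insert_of_mem (Finset.mem_erase.2 ⟨?_, hK he⟩)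
      rintro rfl
      exact hiK he
    · rcases Finset.mem_insert.1 he with rfl | he
      · rw [Finset.card_image_of_injective _ hj.injective]
        simp
      · exact h3 e (Finset.mem_of_mem_erase he)
    · rw [Finset.card_insert_of_notMem hjE, Finset.card_erase_of_mem hiF, hc]
      omega
    · refine le_trans ?_ hs
      rw [Finset.sum_insert hjE, ← Finset.add_sum_erase F _ hiF]
      refine add_le_add ?_ le_rfl
      rw [Finset.prod_image hi.injective.injOn, Finset.prod_image hj.injective.injOn]
      exact Finset.prod_le_prod (fun p _ => hy0 _) fun p _ => hy (hij p)
  have hlt := hmax _ hmem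
  rw [Finset.sum_insert hjE, ← Finset.add_sum_erase F _ hiF, add_le_add_iff_right,
    Finset.sum_image hi.injective.injOn, Finset.sum_image hj.injective.injOn] at hlt
  have heq : i = j := by
    have h1 : ∑ p, (i p : ℕ) = ∑ p, (j p : ℕ) :=
      le_antisymm (Finset.sum_le_sum fun p _ => Fin.le_def.1 (hij p)) hlt
    have h2 := (Finset.sum_eq_sum_iff_of_le fun p _ => Fin.le_def.1 (hij p)).1 h1
    exact funext fun p => Fin.ext (h2 p (Finset.mem_univ p))
  exact hjF (heq ▸ hiF)

theorem exists_sorted_embedding {V : Type*} (f : V → ℝ) {T : Finset V} (hT : T.card = l) :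
    ∃ σ : Fin l ↪ V, Finset.univ.map σ = T ∧ Antitone (f ∘ σ) := by
  subst hT
  let g : Fin T.card → ℝ := fun i => - f (T.equivFin.symm i)
  let σ : Fin T.card ↪ V := ((Tuple.sort g).trans T.equivFin.symm).toEmbedding.trans
    (Function.Embedding.subtype _)
  refine ⟨σ, ?_, fun i j hij => ?_⟩
  · ext v
    simp only [Finset.mem_map, Finset.mem_univ, true_and]
    constructor
    · rintro ⟨i, rfl⟩
      exact (T.equivFin.symm (Tuple.sort g i)).2
    · intro hv
      refine ⟨(Tuple.sort g).symm (T.equivFin ⟨v, hv⟩), ?_⟩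
      simp [σ]
  · have := Tuple.monotone_sort g hij
    simpa [g, σ] using this

/-- A clique-free 3-graph with a weighting of small support, moved to the vertex set `Fin l`
with decreasing weights, and described by its set `R` of non-edges. -/
theorem exists_nonedges (G : RGraph 3 n) (hl : 4 ≤ l) (hG : ¬ G.HasClique (l - 1))
    {x : Fin n → ℝ} (hx : x ∈ stdSimplex ℝ (Fin n)) (hsupp : (support x).card ≤ l) :
    ∃ y ∈ stdSimplex ℝ (Fin l), Antitone y ∧ ∃ R ⊆ Finset.univ.powersetCard 3,
      (∀ v, ∃ e ∈ R, v ∉ e) ∧ l.choose 3 ≤ R.card + G.edges.card ∧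
      G.weight x = ∑ e ∈ Finset.univ.powersetCard 3, ∏ i ∈ e, y i - ∑ e ∈ R, ∏ i ∈ e, y i := by
  classical
  -- The `l` extra vertices of weight zero allow for `n < l`.
  let ι : Fin n ↪ Fin n ⊕ Fin l := Function.Embedding.inl
  let z : Fin n ⊕ Fin l → ℝ := Sum.elim x 0
  obtain ⟨T, hST, -, hT⟩ := Finset.exists_subsuperset_card_eq
    (Finset.subset_univ ((support x).map ι)) (n := l) (by simpa using hsupp) (by simp)
  have hz0 : ∀ u ∉ T, z u = 0 := by
    rintro (u | u) hu
    · have : u ∉ support x := fun h => hu (hST (Finset.mem_map_of_mem ι h))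
      rw [mem_support, not_lt] at this
      exact le_antisymm this (hx.1 u)
    · rfl
  obtain ⟨σ, hσT, hσ⟩ := exists_sorted_embedding z hT
  let E' : Finset (Finset (Fin n ⊕ Fin l)) := G.edges.map (Finset.mapEmbedding ι).toEmbedding
  let E : Finset (Finset (Fin l)) := {e ∈ Finset.univ.powersetCard 3 | e.map σ ∈ E'}
  have hEsub : E ⊆ Finset.univ.powersetCard 3 := Finset.filter_subset _ _
  refine ⟨z ∘ σ, ⟨fun i => ?_, ?_⟩, hσ, Finset.univ.powersetCard 3 \ E, Finset.sdiff_subset,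
    fun v => ?_, ?_, ?_⟩
  · rcases h : σ i with u | u
    · simpa [z, h] using hx.1 u
    · simp [z, h]
  · calc ∑ i, (z ∘ σ) i = ∑ u ∈ T, z u := by
          conv_rhs => rw [← hσT, Finset.sum_map]
          rfl
      _ = ∑ u, z u := Finset.sum_subset (Finset.subset_univ _) fun u _ hu => hz0 u hu
      _ = 1 := by simp [z, Fintype.sum_sum_type, hx.2]
  · by_contra! hv
    have hE : ∀ e ∈ (Finset.univ.erase v).powersetCard 3, e.map σ ∈ E' := by
      intro e he
      rw [Finset.mem_powersetCard] at he
      by_contra heE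
      refine absurd (hv e ?_) fun h => Finset.notMem_erase v _ (he.1 h)
      rw [Finset.mem_sdiff, Finset.mem_powersetCard, Finset.mem_filter]
      exact ⟨⟨Finset.subset_univ _, he.2⟩, fun h => heE h.2⟩
    set Q := (Finset.univ.erase v).map σ with hQ
    have hQc : Q.card = l - 1 := by simp [hQ]
    have hQE : ∀ p ⊆ Q, p.card = 3 → p ∈ E' := by
      intro p hp hp3
      obtain ⟨e, he, rfl⟩ := Finset.subset_map_iff.1 hp
      exact hE e (Finset.mem_powersetCard.2 ⟨he, by simpa using hp3⟩)
    -- As `l - 1 ≥ 3`, each vertex of `Q` lies in an edge, so none of them is an extra vertex.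
    have hQι : ∀ u ∈ Q, ∃ i, ι i = u := by
      intro u hu
      obtain ⟨p, hup, hpQ, hp⟩ := Finset.exists_subsuperset_card_eq
        (Finset.singleton_subset_iff.2 hu) (n := 3) (by simp) (by omega)
      obtain ⟨e, -, he⟩ := Finset.mem_map.1 (hQE p hpQ hp)
      have : u ∈ e.map ι := by
        rw [Finset.singleton_subset_iff, ← he] at hup
        exact hup
      obtain ⟨i, -, hi⟩ := Finset.mem_map.1 this
      exact ⟨i, hi⟩
    have hQmap : ({i | ι i ∈ Q} : Finset (Fin n)).map ι = Q := by
      ext u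
      simp only [Finset.mem_map, Finset.mem_filter, Finset.mem_univ, true_and]
      constructor
      · rintro ⟨i, hi, rfl⟩
        exact hi
      · intro hu
        obtain ⟨i, rfl⟩ := hQι u hu
        exact ⟨i, hu, rfl⟩
    refine hG ⟨({i | ι i ∈ Q} : Finset (Fin n)), ?_, fun p hp => ?_⟩
    · rw [← Finset.card_map ι, hQmap, hQc]
    · rw [Finset.mem_powersetCard] at hp
      have h1 := hQE (p.map ι) (hQmap ▸ Finset.map_subset_map.2 hp.1) (by simpa using hp.2)
      obtain ⟨e, he, hep⟩ := Finset.mem_map.1 h1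
      rwa [← Finset.map_injective ι hep]
  · have h1 : E.card ≤ G.edges.card := by
      rw [← Finset.card_map (Finset.mapEmbedding ι).toEmbedding]
      exact Finset.card_le_card_of_injOn (fun e => e.map σ)
        (fun e he => (Finset.mem_filter.1 he).2) (Finset.map_injective σ).injOn
    have h2 := Finset.card_sdiff_add_card_eq_card hEsub
    rw [Finset.card_powersetCard, Finset.card_univ, Fintype.card_fin] at h2
    omega
  · rw [← Finset.sum_sdiff hEsub, add_sub_cancel_left]
    have h1 : G.weight x = ∑ e ∈ E', ∏ u ∈ e, z u := by
      simp [E', weight, z, ι]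
    have h2 : ∑ e ∈ E, ∏ i ∈ e, (z ∘ σ) i =
        ∑ e ∈ E.map (Finset.mapEmbedding σ).toEmbedding, ∏ u ∈ e, z u := by
      simp
    rw [h1, h2]
    refine (Finset.sum_subset (fun e he => ?_) fun e he heE => ?_).symm
    · obtain ⟨e', he', rfl⟩ := Finset.mem_map.1 he
      exact (Finset.mem_filter.1 he').2
    · by_contra hne
      have heT : e ⊆ Finset.univ.map σ := by
        intro u hu
        rw [hσT]
        by_contra huT
        exact hne (Finset.prod_eq_zero hu (hz0 u huT))
      obtain ⟨e', -, rfl⟩ := Finset.subset_map_iff.1 heT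
      refine heE (Finset.mem_map.2 ⟨e', Finset.mem_filter.2 ⟨?_, he⟩, rfl⟩)
      obtain ⟨e'', he'', h⟩ := Finset.mem_map.1 he
      rw [Finset.mem_powersetCard]
      refine ⟨Finset.subset_univ _, ?_⟩
      rw [← Finset.card_map σ, ← h, ← G.card_of_mem e'' he'']
      exact Finset.card_map ι

end RGraph

/-! ### Five vertices: weights below `1 / 16` -/

namespace RGraph

theorem sum_powersetCard_three_insert {ι : Type*} [DecidableEq ι] {a : ι} {S : Finset ι}
    (ha : a ∉ S) (y : ι → ℝ) :
    ∑ e ∈ (insert a S).powersetCard 3, ∏ i ∈ e, y i =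
      ∑ e ∈ S.powersetCard 3, ∏ i ∈ e, y i + y a * ∑ p ∈ S.powersetCard 2, ∏ i ∈ p, y i := by
  have hnot : ∀ p ∈ S.powersetCard 2, a ∉ p := fun p hp h =>
    ha ((Finset.mem_powersetCard.1 hp).1 h)
  rw [Finset.powersetCard_succ_insert ha, Finset.sum_union, Finset.sum_image, Finset.mul_sum]
  · congr 1
    exact Finset.sum_congr rfl fun p hp => Finset.prod_insert (hnot p hp)
  · intro p hp p' hp' h
    rw [← Finset.erase_insert (hnot p hp), ← Finset.erase_insert (hnot p' hp')]
    exact congrArg (fun s => Finset.erase s a) h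
  · rw [Finset.disjoint_left]
    intro p hp hp'
    obtain ⟨p', _, rfl⟩ := Finset.mem_image.1 hp'
    exact ha ((Finset.mem_powersetCard.1 hp).1 (Finset.mem_insert_self a p'))

/-- The remaining triples all contain vertex 0. With `t` the weight of the other four, the sum is at
most `3 / 8 * (1 - t) * t ^ 2`, whose maximum is `1 / 18`, at `t = 2 / 3`. -/
theorem star_weight_lt {y : Fin 5 → ℝ} (hy : y ∈ stdSimplex ℝ (Fin 5)) :
    ∑ e ∈ Finset.univ.powersetCard 3, ∏ i ∈ e, y i -
      ∑ e ∈ (lastFour 5).powersetCard 3, ∏ i ∈ e, y i < 1 / 16 := by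
  have h0 : (0 : Fin 5) ∉ lastFour 5 := by simp [mem_lastFour]
  have hu : (Finset.univ : Finset (Fin 5)) = insert 0 (lastFour 5) := by decide
  have hs := hy.2
  rw [hu, Finset.sum_insert h0] at hs
  have h2 := two_mul_sum_powersetCard_two (lastFour 5) y
  have h3 : (∑ i ∈ lastFour 5, y i) ^ 2 ≤ (lastFour 5).card * ∑ i ∈ lastFour 5, y i ^ 2 :=
    sq_sum_le_card_mul_sum_sq
  rw [card_lastFour (by norm_num)] at h3
  rw [hu, sum_powersetCard_three_insert h0, add_sub_cancel_left]
  set t := ∑ i ∈ lastFour 5, y i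
  set P := ∑ p ∈ (lastFour 5).powersetCard 2, ∏ i ∈ p, y i
  have hy0 := hy.1 0
  have ht : 0 ≤ t := Finset.sum_nonneg fun i _ => hy.1 i
  push_cast at h3
  have h4 : P ≤ 3 / 8 * t ^ 2 := by linarith
  have h5 : y 0 * P ≤ y 0 * (3 / 8 * t ^ 2) := mul_le_mul_of_nonneg_left h4 hy0
  have h6 : y 0 = 1 - t := by linarith
  rw [h6] at h5 hy0 ⊢
  nlinarith [mul_nonneg ht (sq_nonneg (t - 2 / 3)), sq_nonneg (t - 2 / 3)]

/-- The non-edges are `abc`, `ade`, `cde`. Averaging `a` with `c` and `d` with `e` leaves a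
polynomial in `p` and `s`. -/
theorem seven_edge_weight_lt {a b c d e : ℝ} (ha : 0 ≤ a) (hb : 0 ≤ b) (hc : 0 ≤ c) (hd : 0 ≤ d)
    (he : 0 ≤ e) (h : a + b + c + d + e = 1) :
    (a * b + a * c + b * c) * (d + e) + b * d * e < 1 / 16 := by
  obtain ⟨p, hp⟩ : ∃ p, p = a + c := ⟨_, rfl⟩
  obtain ⟨s, hs⟩ : ∃ s, s = d + e := ⟨_, rfl⟩
  have hs0 : 0 ≤ s := by linarith
  have hs1 : s ≤ 1 := by linarith
  have h1 : a * c * s ≤ p ^ 2 / 4 * s := by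
    refine mul_le_mul_of_nonneg_right ?_ hs0
    rw [hp]
    nlinarith [sq_nonneg (a - c)]
  have h2 : b * (d * e) ≤ b * (s ^ 2 / 4) := by
    refine mul_le_mul_of_nonneg_left ?_ hb
    rw [hs]
    nlinarith [sq_nonneg (d - e)]
  have h3 : (a * b + a * c + b * c) * (d + e) + b * d * e =
      b * p * s + a * c * s + b * (d * e) := by
    rw [hp, hs]
    ring
  have hb' : b = 1 - p - s := by linarith
  rw [h3]
  rw [hb'] at h2 ⊢
  -- For fixed `s` the maximum is at `p = (4 - 5 * s) / 6`; the cubic left in `s` peaks near `2 /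
  -- 5`.
  have h4 : 0 ≤ s * (6 * p - (4 - 5 * s)) ^ 2 := by positivity
  have h5 : 0 ≤ (s - 2 / 5) ^ 2 * (88 / 5 - 13 * s) :=
    mul_nonneg (sq_nonneg _) (by linarith)
  nlinarith

theorem sum_powersetCard_three_five {a b c d e : Fin 5} (hu : [a, b, c, d, e].Nodup)
    (y : Fin 5 → ℝ) :
    ∑ f ∈ Finset.univ.powersetCard 3, ∏ i ∈ f, y i =
      y a * y b * (y c + y d + y e) + y c * y d * (y a + y b + y e) +
      y e * (y a + y b) * (y c + y d) := by
  have huniv : (Finset.univ : Finset (Fin 5)) = {a, b, c, d, e} := by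
    refine (Finset.eq_univ_of_card _ ?_).symm
    have := List.toFinset_card_of_nodup hu
    simpa using this
  simp only [List.nodup_cons, List.mem_cons, List.not_mem_nil, or_false, not_or,
    List.nodup_nil, and_true, not_false_eq_true] at hu
  obtain ⟨⟨hab, hac, had, hae⟩, ⟨hbc, hbd, hbe⟩, ⟨hcd, hce⟩, hde⟩ := hu
  have h2 : ∀ S : Finset (Fin 5), ∑ p ∈ S.powersetCard 2, ∏ i ∈ p, y i =
      ((∑ i ∈ S, y i) ^ 2 - ∑ i ∈ S, y i ^ 2) / 2 := fun S => by
    have := two_mul_sum_powersetCard_two S y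
    linarith
  have h3 : ({d, e} : Finset (Fin 5)).powersetCard 3 = ∅ :=
    Finset.powersetCard_eq_empty.2 (by rw [Finset.card_pair hde]; norm_num)
  rw [huniv, sum_powersetCard_three_insert (by simp [*]), sum_powersetCard_three_insert (by simp [*]),
    sum_powersetCard_three_insert (by simp [*]), h3, h2, h2, h2]
  simp only [Finset.sum_empty, Finset.sum_pair hde,
    Finset.sum_insert (show c ∉ ({d, e} : Finset (Fin 5)) by simp [*]),
    Finset.sum_insert (show b ∉ ({c, d, e} : Finset (Fin 5)) by simp [*])]
  ring

theorem ne_and_ne_iff_of_cover {α : Type*} {a b c d e v : α}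
    (hv : v = a ∨ v = b ∨ v = c ∨ v = d ∨ v = e) (hba : b ≠ a) (hbc : b ≠ c) (hda : d ≠ a)
    (hdc : d ≠ c) (hea : e ≠ a) (hec : e ≠ c) : v ≠ c ∧ v ≠ a ↔ v = b ∨ v = d ∨ v = e := by
  constructor
  · tauto
  · rintro (rfl | rfl | rfl)
    · exact ⟨hbc, hba⟩
    · exact ⟨hdc, hda⟩
    · exact ⟨hec, hea⟩

/-- `p` and `q` cover all five vertices and share `c`. The triple `f` misses `c` and one further
vertex `z`; each choice of `z` gives the 3-graph of `seven_edge_weight_lt` up to relabelling. -/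
theorem three_nonedges_of_inter {y : Fin 5 → ℝ} (hy : y ∈ stdSimplex ℝ (Fin 5))
    {p q f : Finset (Fin 5)} (hp : p.card = 3) (hq : q.card = 3) (hf : f.card = 3)
    (hpq : (p ∩ q).card = 1) (hpqf : Disjoint (p ∩ q) f) :
    ∑ e ∈ Finset.univ.powersetCard 3, ∏ i ∈ e, y i -
      (∏ i ∈ p, y i + ∏ i ∈ q, y i + ∏ i ∈ f, y i) < 1 / 16 := by
  obtain ⟨c, hc⟩ := Finset.card_eq_one.1 hpq
  have hcp : c ∈ p ∩ q := by simp [hc]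
  rw [Finset.mem_inter] at hcp
  have hcf : c ∉ f := by
    rw [hc, Finset.disjoint_singleton_left] at hpqf
    exact hpqf
  obtain ⟨a, b, hab, hpab⟩ := Finset.card_eq_two.1
    (show (p.erase c).card = 2 by rw [Finset.card_erase_of_mem hcp.1, hp])
  obtain ⟨d, e, hde, hqde⟩ := Finset.card_eq_two.1
    (show (q.erase c).card = 2 by rw [Finset.card_erase_of_mem hcp.2, hq])
  obtain ⟨z, hz⟩ := Finset.card_eq_one.1
    (show (fᶜ.erase c).card = 1 by
      rw [Finset.card_erase_of_mem (by simpa using hcf), Finset.card_compl, hf]; rfl)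
  have ma : a ∈ p.erase c := by simp [hpab]
  have mb : b ∈ p.erase c := by simp [hpab]
  have md : d ∈ q.erase c := by simp [hqde]
  have me : e ∈ q.erase c := by simp [hqde]
  have hinter : ∀ u, u ∈ p → u ∈ q → u = c := fun u h1 h2 => by
    have : u ∈ p ∩ q := Finset.mem_inter.2 ⟨h1, h2⟩
    simpa [hc] using this
  rw [Finset.mem_erase] at ma mb md me
  have had : a ≠ d := fun h => ma.1 (hinter a ma.2 (h ▸ md.2))
  have hae : a ≠ e := fun h => ma.1 (hinter a ma.2 (h ▸ me.2))
  have hbd : b ≠ d := fun h => mb.1 (hinter b mb.2 (h ▸ md.2))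
  have hbe : b ≠ e := fun h => mb.1 (hinter b mb.2 (h ▸ me.2))
  have hu : [a, b, c, d, e].Nodup := by
    simp [hab, ma.1, mb.1, had, hae, hbd, hbe, hde, md.1.symm, me.1.symm]
  have huniv : (Finset.univ : Finset (Fin 5)) = {a, b, c, d, e} := by
    refine (Finset.eq_univ_of_card _ ?_).symm
    have := List.toFinset_card_of_nodup hu
    simpa using this
  have hsum : y a + y b + y c + y d + y e = 1 := by
    rw [← hy.2, huniv, Finset.sum_insert (by simp [hab, ma.1, had, hae]),
      Finset.sum_insert (by simp [mb.1, hbd, hbe]),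
      Finset.sum_insert (by simp [md.1.symm, me.1.symm]), Finset.sum_pair hde]
    ring
  have hpp : ∏ i ∈ p, y i = y c * (y a * y b) := by
    rw [← Finset.mul_prod_erase p y hcp.1, hpab, Finset.prod_pair hab]
  have hqq : ∏ i ∈ q, y i = y c * (y d * y e) := by
    rw [← Finset.mul_prod_erase q y hcp.2, hqde, Finset.prod_pair hde]
  have hfm : ∀ u, u ∈ f ↔ u ≠ c ∧ u ≠ z := fun u => by
    have h : u ∈ fᶜ.erase c ↔ u = z := by rw [hz, Finset.mem_singleton]
    rw [Finset.mem_erase, Finset.mem_compl] at h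
    constructor
    · intro hu
      refine ⟨fun h' => hcf (h' ▸ hu), fun h' => (h.2 h').2 hu⟩
    · rintro ⟨h1, h2⟩
      by_contra h3
      exact h2 (h.1 ⟨h1, h3⟩)
  have hzc : z ≠ c := by
    have : z ∈ fᶜ.erase c := by simp [hz]
    exact Finset.ne_of_mem_erase this
  have hz' : z ∈ ({a, b, c, d, e} : Finset (Fin 5)) := huniv ▸ Finset.mem_univ z
  have hcov : ∀ u, u = a ∨ u = b ∨ u = c ∨ u = d ∨ u = e := fun u => by
    have : u ∈ ({a, b, c, d, e} : Finset (Fin 5)) := huniv ▸ Finset.mem_univ u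
    simpa using this
  rw [sum_powersetCard_three_five hu, hpp, hqq]
  have y0 := hy.1
  have hprod : ∀ s t u : Fin 5, s ≠ t → s ≠ u → t ≠ u →
      (∀ v, v ≠ c ∧ v ≠ z ↔ v = s ∨ v = t ∨ v = u) → ∏ i ∈ f, y i = y s * y t * y u := by
    intro s t u hst hsu htu h
    have hfe : f = {s, t, u} := by
      ext v
      rw [hfm, h]
      simp
    rw [hfe, Finset.prod_insert (by simp [hst, hsu]), Finset.prod_pair htu, mul_assoc]
  simp only [Finset.mem_insert, Finset.mem_singleton] at hz'
  rcases hz' with rfl | rfl | rfl | rfl | rfl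
  · rw [hprod b d e hbd hbe hde
      fun v => ne_and_ne_iff_of_cover (by have := hcov v; tauto) hab.symm mb.1 had.symm md.1 hae.symm me.1]
    have := seven_edge_weight_lt (y0 b) (y0 z) (y0 c) (y0 d) (y0 e) (by linarith)
    linarith
  · rw [hprod a d e had hae hde
      fun v => ne_and_ne_iff_of_cover (by have := hcov v; tauto) hab ma.1 hbd.symm md.1 hbe.symm me.1]
    have := seven_edge_weight_lt (y0 a) (y0 z) (y0 c) (y0 d) (y0 e) (by linarith)
    linarith
  · exact absurd rfl hzc
  · rw [hprod a b e hab hae hbe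
      fun v => ne_and_ne_iff_of_cover (by have := hcov v; tauto) had ma.1 hbd mb.1 hde.symm me.1]
    have := seven_edge_weight_lt (y0 e) (y0 z) (y0 c) (y0 a) (y0 b) (by linarith)
    linarith
  · rw [hprod a b d hab had hbd
      fun v => ne_and_ne_iff_of_cover (by have := hcov v; tauto) hae ma.1 hbe mb.1 hde md.1]
    have := seven_edge_weight_lt (y0 d) (y0 z) (y0 c) (y0 a) (y0 b) (by linarith)
    linarith

theorem three_nonedges_weight_lt {y : Fin 5 → ℝ} (hy : y ∈ stdSimplex ℝ (Fin 5))
    {R : Finset (Finset (Fin 5))} (hR : ∀ e ∈ R, e.card = 3) (hR3 : R.card = 3)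
    (hcommon : ∀ v, ∃ e ∈ R, v ∉ e) :
    ∑ e ∈ Finset.univ.powersetCard 3, ∏ i ∈ e, y i - ∑ e ∈ R, ∏ i ∈ e, y i < 1 / 16 := by
  obtain ⟨p, q, f, hpq, hpf, hqf, rfl⟩ := Finset.card_eq_three.1 hR3
  have hp : p.card = 3 := hR p (by simp)
  have hq : q.card = 3 := hR q (by simp)
  have hf : f.card = 3 := hR f (by simp)
  have hdisj : Disjoint (p ∩ q) f := by
    rw [Finset.disjoint_left]
    intro v hv hvf
    rw [Finset.mem_inter] at hv
    obtain ⟨e, he, hve⟩ := hcommon v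
    simp only [Finset.mem_insert, Finset.mem_singleton] at he
    rcases he with rfl | rfl | rfl
    · exact hve hv.1
    · exact hve hv.2
    · exact hve hvf
  rw [Finset.sum_insert (by simp [hpq, hpf]), Finset.sum_pair hqf]
  have h1 := Finset.card_union_add_card_inter p q
  have h2 : (p ∪ q).card ≤ 5 := card_finset_fin_le _
  have h3 := Finset.card_union_of_disjoint hdisj
  have h4 : (p ∩ q ∪ f).card ≤ 5 := card_finset_fin_le _
  rcases (show (p ∩ q).card = 1 ∨ (p ∩ q).card = 2 by omega) with h | h
  · have := three_nonedges_of_inter hy hp hq hf h hdisj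
    linarith
  -- Here `f` is the complement of `p ∩ q`, so `p` and `f` share exactly one vertex and take over
  -- the roles of `p` and `q`.
  · have hu : p ∩ q ∪ f = Finset.univ := Finset.eq_univ_of_card _ (by simp; omega)
    have h5 : p ∩ f = p \ (p ∩ q) := by
      ext v
      have hv : v ∈ p ∩ q ∪ f := hu ▸ Finset.mem_univ v
      have hd : v ∈ p ∩ q → v ∉ f := fun h => Finset.disjoint_left.1 hdisj h
      simp only [Finset.mem_union, Finset.mem_inter, Finset.mem_sdiff] at hv hd ⊢
      tauto
    have h6 : (p ∩ f).card = 1 := by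
      rw [h5, Finset.card_sdiff_of_subset Finset.inter_subset_left]
      omega
    have h7 : Disjoint (p ∩ f) q := by
      rw [Finset.disjoint_left] at hdisj ⊢
      intro v hv hvq
      rw [Finset.mem_inter] at hv
      exact hdisj (Finset.mem_inter.2 ⟨hv.1, hvq⟩) hv.2
    have := three_nonedges_of_inter hy hp hf hq h6 h7
    linarith

end RGraph

/-! ### Compression, the exceptional case, and the conclusion -/

namespace RGraph

variable {n m l : ℕ}

theorem exists_leftCompressed_ge (hl : 5 ≤ l) (hN : m + 4 ≤ l.choose 3)
    (hm : m ≤ (l - 1).choose 3 + (l - 2).choose 2) (G : RGraph 3 n) (hGm : G.edges.card = m)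
    (hG : ¬ G.HasClique (l - 1)) (hL : (complete 3 (l - 1)).lagrangian ≤ G.lagrangian)
    (hn : 0 < n) :
    ∃ G' : RGraph 3 l, (G'.LeftCompressed ∧ G'.edges.card = m ∧ ¬ G'.HasClique (l - 1)) ∧
      G.lagrangian ≤ G'.lagrangian := by
  classical
  obtain ⟨⟨x, hx, hopt⟩, -⟩ := G.isGreatest_lagrangian hn
  have hsupp := G.card_support_le (q := l - 1) (by omega) (hGm.trans_le hm) hL hx hopt
  obtain ⟨y, hy, hanti, R, hR, hcommon, hcard, hw⟩ :=
    G.exists_nonedges (l := l) (by omega) hG hx (by omega)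
  obtain ⟨F, hK, hF3, hFc, hFs, hFup⟩ := exists_upper_family hl hanti hy.1
    (fun e he => (Finset.mem_powersetCard.1 (hR he)).2) (N := l.choose 3 - m) (by omega) (by omega)
    hcommon
  have hFsub : F ⊆ Finset.univ.powersetCard 3 := fun e he =>
    Finset.mem_powersetCard.2 ⟨Finset.subset_univ e, hF3 e he⟩
  let G' : RGraph 3 l :=
    ⟨Finset.univ.powersetCard 3 \ F, fun e he =>
      (Finset.mem_powersetCard.1 (Finset.mem_sdiff.1 he).1).2⟩
  refine ⟨G', ⟨fun i j hi hj hij hje => ?_, ?_, ?_⟩, ?_⟩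
  · refine Finset.mem_sdiff.2 ⟨Finset.mem_powersetCard.2 ⟨Finset.subset_univ _, ?_⟩, fun hiF => ?_⟩
    · rw [Finset.card_image_of_injective _ hi.injective]
      simp
    · exact (Finset.mem_sdiff.1 hje).2 (hFup i j hi hj hij hiF)
  · change (Finset.univ.powersetCard 3 \ F).card = m
    rw [Finset.card_sdiff_of_subset hFsub, Finset.card_powersetCard, hFc, Finset.card_univ,
      Fintype.card_fin]
    omega
  -- A set of `l - 1` vertices misses at most one of the last four, so it contains a triple of the
  -- block.
  · rintro ⟨S, hS, hSE⟩
    have h1 := Finset.card_union_add_card_inter S (lastFour l)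
    have h2 : (S ∪ lastFour l).card ≤ l := card_finset_fin_le _
    rw [card_lastFour (by omega)] at h1
    obtain ⟨e, he, he3⟩ := Finset.exists_subset_card_eq (show 3 ≤ (S ∩ lastFour l).card by omega)
    have h3 := hSE (Finset.mem_powersetCard.2 ⟨he.trans Finset.inter_subset_left, he3⟩)
    exact (Finset.mem_sdiff.1 h3).2
      (hK (Finset.mem_powersetCard.2 ⟨he.trans Finset.inter_subset_right, he3⟩))
  · refine le_trans ?_ (G'.weight_le_lagrangian hy)
    have h1 : G'.weight y = ∑ e ∈ Finset.univ.powersetCard 3, ∏ i ∈ e, y i -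
        ∑ e ∈ F, ∏ i ∈ e, y i := by
      rw [← Finset.sum_sdiff hFsub, add_sub_cancel_right]
      rfl
    rw [← hopt, hw, h1]
    linarith

theorem pos_of_edges_card_pos (G : RGraph 3 n) (hG : 0 < G.edges.card) : 0 < n := by
  obtain ⟨e, he⟩ := Finset.card_pos.1 hG
  have h1 := G.card_of_mem e he
  have h2 := card_finset_fin_le e
  omega

/-- Uniform weights on four vertices give the threshold `4 / 64 = 1 / 16`. The non-edges number
three, or at least four when some edges leave the chosen five vertices; both cases stay below it. -/
theorem pengZhao_seven_five : PengZhaoConjecture 3 7 5 := by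
  intro n G hGm hG
  by_contra! hL
  have hn : 0 < n := G.pos_of_edges_card_pos (by omega)
  obtain ⟨⟨x, hx, hopt⟩, -⟩ := G.isGreatest_lagrangian hn
  have hsupp := G.card_support_le (q := 4) le_rfl (hGm.trans_le (by decide)) hL hx hopt
  obtain ⟨y, hy, hanti, R, hR, hcommon, hcard, hw⟩ :=
    G.exists_nonedges (l := 5) (by omega) hG hx hsupp
  have hR3 : ∀ e ∈ R, e.card = 3 := fun e he => (Finset.mem_powersetCard.1 (hR he)).2
  have hlow := choose_le_lagrangian_complete (q := 4) (by norm_num)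
  have h16 : 1 / 16 ≤ G.weight x := by
    rw [hopt]
    refine le_trans ?_ hL
    norm_num [Nat.choose] at hlow ⊢
    linarith
  rw [hw] at h16
  have hcard3 : 3 ≤ R.card := by
    have : (5 : ℕ).choose 3 = 10 := by decide
    omega
  rcases Nat.lt_or_ge R.card 4 with h | h
  · linarith [three_nonedges_weight_lt hy hR3 (by omega) hcommon]
  · obtain ⟨F, hK, hF3, hFc, hFs⟩ :=
      exists_superset_lastFour le_rfl hanti hy.1 hR3 h hcommon
    have h1 := Finset.sum_le_sum_of_subset_of_nonneg hK (f := fun e => ∏ i ∈ e, y i)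
      fun e _ _ => Finset.prod_nonneg fun i _ => hy.1 i
    linarith [star_weight_lt hy]

theorem finite_rGraph (r n : ℕ) : Finite (RGraph r n) :=
  Finite.of_injective RGraph.edges fun _ _ h => RGraph.ext h

theorem exists_leftCompressed_isGreatest (hm0 : 0 < m) (hl : 5 ≤ l) (hN : m + 4 ≤ l.choose 3)
    (hm : m ≤ (l - 1).choose 3 + (l - 2).choose 2) (hPZ : ¬ PengZhaoConjecture 3 m l) :
    ∃ G : RGraph 3 l, G.LeftCompressed ∧ G.edges.card = m ∧ ¬ G.HasClique (l - 1) ∧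
      IsGreatest (lagrangiansWithoutClique 3 m (l - 1)) G.lagrangian := by
  unfold PengZhaoConjecture at hPZ
  push Not at hPZ
  obtain ⟨n₀, G₀, hG₀m, hG₀, hL₀⟩ := hPZ
  obtain ⟨G₁, hG₁, hL₁⟩ := exists_leftCompressed_ge hl hN hm G₀ hG₀m hG₀ hL₀
    (G₀.pos_of_edges_card_pos (by omega))
  have := finite_rGraph 3 l
  obtain ⟨G, ⟨hGl, hGm, hGc⟩, hmax⟩ := Set.exists_max_image
    {G : RGraph 3 l | G.LeftCompressed ∧ G.edges.card = m ∧ ¬ G.HasClique (l - 1)}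
    lagrangian (Set.toFinite _) ⟨G₁, hG₁⟩
  refine ⟨G, hGl, hGm, hGc, ⟨l, G, hGm, hGc, rfl⟩, ?_⟩
  rintro _ ⟨n, H, hHm, hHc, rfl⟩
  rcases le_total (complete 3 (l - 1)).lagrangian H.lagrangian with h | h
  · obtain ⟨H', hH', hle⟩ := exists_leftCompressed_ge hl hN hm H hHm hHc h
      (H.pos_of_edges_card_pos (by omega))
    exact hle.trans (hmax H' hH')
  -- A 3-graph below the complete one is beaten by way of the counterexample `G₀`.
  · exact h.trans (hL₀.trans (hL₁.trans (hmax G₁ hG₁)))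

/-- Vacuous: a single edge is already a clique of order 3. -/
theorem pengZhao_four (hm : 0 < m) : PengZhaoConjecture 3 m 4 := by
  intro n G hGm hG
  obtain ⟨e, he⟩ := Finset.card_pos.1 (hGm ▸ hm)
  refine absurd ⟨e, G.card_of_mem e he, ?_⟩ hG
  have := Finset.powersetCard_self e
  rw [G.card_of_mem e he] at this
  rw [this]
  simpa using he

theorem choose_three_eq (hl : 5 ≤ l) :
    l.choose 3 = (l - 1).choose 3 + (l - 2).choose 2 + (l - 2) := by
  obtain ⟨s, rfl⟩ := Nat.exists_eq_add_of_le' hl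
  simp only [show s + 5 - 1 = s + 4 by omega, show s + 5 - 2 = s + 3 by omega]
  rw [Nat.choose_succ_succ' (s + 4) 2, Nat.choose_succ_succ' (s + 3) 1, Nat.choose_one_right]
  ring

end RGraph

theorem lemma3p1 (m l : ℕ) (hm : 0 < m) (hl : 0 < l)
    (hlow : (l - 1).choose 3 ≤ m)
    (hupp : m ≤ (l - 1).choose 3 + (l - 2).choose 2) :
    (∃ G : RGraph 3 l, G.LeftCompressed ∧ G.edges.card = m ∧ ¬ G.HasClique (l - 1) ∧
      IsGreatest (RGraph.lagrangiansWithoutClique 3 m (l - 1)) G.lagrangian) ∨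
    RGraph.PengZhaoConjecture 3 m l := by
  rcases Nat.lt_or_ge l 5 with h5 | h5
  · right
    interval_cases l
    -- For `l ≤ 3` both binomials vanish, against `m > 0`.
    iterate 3 exact absurd hupp (by simpa [Nat.choose] using hm.ne')
    · exact RGraph.pengZhao_four hm
  · have hc := RGraph.choose_three_eq h5
    by_cases hN : m + 4 ≤ l.choose 3
    · by_cases hPZ : RGraph.PengZhaoConjecture 3 m l
      · exact Or.inr hPZ
      · exact Or.inl (RGraph.exists_leftCompressed_isGreatest hm h5 hN hupp hPZ)
    · right
      obtain rfl : l = 5 := by omega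
      obtain rfl : m = 7 := by
        have h1 : (5 : ℕ).choose 3 = 10 := by decide
        omega
      exact RGraph.pengZhao_seven_five
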